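/- Let $n\in\mathbb N$ and let $p(x,y)=xy-\sum_{s=0}^4 q_sx^s$ with $q_s\in\mathbb R$, $q_0\neq 0$, $q_4=1$. Let $\beta=(\beta_{i,j})_{i,j\ge 0,\ i+j\le 2n}$ be a real sequence, with moment matrix $M(n)=(\beta_{\mathbf i+\mathbf j})_{|\mathbf i|,|\mathbf j|\le n}$, rows and columns indexed by $\mathbf i,\mathbf j\in\mathbb Z_{\ge0}^2$. For $r=\sum a_{i,j}x^iy^j\in\mathbb R[x,y]$ with $\deg r\le n$, we say that $r(X,Y)=\mathbf 0$ is a column relation of $M(n)$ if the linear combination of the columns of $M(n)$ with coefficients $a_{i,j}$ vanishes. Assume that $\beta$ is $p$-pure: $\deg p\le n$, and the column relations of $M(n)$ are exactly the relations $(ps)(X,Y)=\mathbf 0$ with $s\in\mathbb R[x,y]$, $\deg(ps)\le n$. For $j\ge 0$ let the numbers $q_{j,t}$, $-j\le t\le 3j$, be defined by $\big(\sum_{s=0}^4 q_sx^{s-1}\big)^j=\sum_{t=-j}^{3j}q_{j,t}x^t$. For $(t_1,t_2,t_3)\in\mathbb R^3$ define $\gamma_s=\gamma_s(t_1,t_2,t_3)$,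 $-2n\le s\le 6n$, as follows. The free moments are $\gamma_{6n-3}=t_1$, $\gamma_{6n-1}=t_2$, $\gamma_{6n}=t_3$. Further $\gamma_s=\beta_{s,0}$ for $0\le s\le 2n$. Then, for $k=1,2,\dots,2n$ successively, define in this order $$\gamma_{-k}=\frac1{q_0^k}\Big(\beta_{0,k}-\sum_{t=-k+1}^{3k}q_{k,t}\gamma_t\Big),$$ $$\gamma_{2n+2k-1}=\beta_{2n-k-1,k}-\sum_{t=-k}^{3k-1}q_{k,t}\gamma_{t+2n-k-1}\quad(\text{only if }k\le 2n-2),$$ $$\gamma_{2n+2k}=\beta_{2n-k,k}-\sum_{t=-k}^{3k-1}q_{k,t}\gamma_{t+2n-k}\quad(\text{only if }k\le 2n-1).$$ Put $A=(\gamma_{i+j})_{i,j=-n+1}^{3n-2}$ (which does not depend on $t_1,t_2,t_3$) and $F_1=(\gamma_{i+j})_{i,j=-n+1}^{3n-1}$ (which depends only on $t_1$), and assume that $A$ is positive definite; then $\det F_1(t_1)$ is a quadratic polynomial in $t_1$. Write $$c_1=(\gamma_{2n},\dots,\gamma_{6n-3})^T,\quad v=(\gamma_{2n+1},\dots,\gamma_{6n-2})^T,\quad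 w_1=\gamma_{6n-2}-c_1^TA^{-1}c_1,$$ $$B=F_1,\quad c_2=(\gamma_{2n+1},\dots,\gamma_{6n-1})^T,\quad z_2=(\gamma_{-2n+1},\dots,\gamma_{2n-1})^T,\quad w_2=t_3-c_2^TB^{-1}c_2 .$$ Suppose that there exists $(t_1,t_2,t_3)\in\mathbb R^3$ such that: 1. the quadratic polynomial $\det F_1$ has real zeros $(t_1)_-\le (t_1)_+$, and $(t_1)_-<t_1<(t_1)_+$; 2. $\displaystyle t_3> v^T\Big(A^{-1}+\frac1{w_1}A^{-1}c_1c_1^TA^{-1}\Big)v-\frac{2t_2}{w_1}\,v^TA^{-1}c_1+\frac{t_2^2}{w_1};$ 3. $\displaystyle \gamma_{-2n}> z_2^T\Big(B^{-1}+\frac1{w_2}B^{-1}c_2c_2^TB^{-1}\Big)z_2-\frac{2\gamma_{2n}}{w_2}\,z_2^TB^{-1}c_2+\frac{\gamma_{2n}^2}{w_2}.$ Then $\beta$ admits a $\mathcal Z(p)$-representing measure, i.e. there is a positive Borel measure $\mu$ on $\mathbb R^2$ with $\operatorname{supp}\mu\subseteq\mathcal Z(p)=\{(x,y)\in\mathbb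 R^2: p(x,y)=0\}$ such that all monomials $x^iy^j$ with $i+j\le 2n$ are $\mu$-integrable and $\beta_{i,j}=\int x^iy^j\,d\mu$. -/

import Mathlib

open MeasureTheory Matrix

noncomputable section

namespace QuarticTMP

/-! ### Bivariate truncated moment sequences

A sequence of degree `2n` is given by `β : ℕ → ℕ → ℝ`; only the entries `β i j` with
`i + j ≤ 2 * n` are ever used.  The variables `x`, `y` are `X 0`, `X 1`. -/

/-- The zero set of a bivariate polynomial in the real plane. -/
def zeroSet (p : MvPolynomial (Fin 2) ℝ) : Set (ℝ × ℝ) :=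
  {z | MvPolynomial.eval ![z.1, z.2] p = 0}

/-- `μ` is a (positive Borel) measure supported on `K` representing the sequence `β` of
degree `2n`. -/
def IsRepresentingMeasure (n : ℕ) (β : ℕ → ℕ → ℝ) (K : Set (ℝ × ℝ))
    (μ : Measure (ℝ × ℝ)) : Prop :=
  μ.support ⊆ K ∧
    ∀ i j : ℕ, i + j ≤ 2 * n →
      Integrable (fun z : ℝ × ℝ => z.1 ^ i * z.2 ^ j) μ ∧
        β i j = ∫ z : ℝ × ℝ, z.1 ^ i * z.2 ^ j ∂μ

/-- The exponents `(i, j)` of the monomials `x ^ i * y ^ j` of degree at most `n`. -/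
def exponents (n : ℕ) : Finset (ℕ × ℕ) :=
  (Finset.range (n + 1) ×ˢ Finset.range (n + 1)).filter fun d => d.1 + d.2 ≤ n

/-- The moment matrix `M(n)` of `β`. -/
def momentMatrix (n : ℕ) (β : ℕ → ℕ → ℝ) : Matrix (exponents n) (exponents n) ℝ :=
  Matrix.of fun i j => β (i.1.1 + j.1.1) (i.1.2 + j.1.2)

/-- The column relation `r(X, Y) = 0` of `M(n)`, for `r` of degree at most `n`: the linear
combination of the columns of `M(n)` with the coefficients of `r` vanishes. -/
def ColumnRelation (n : ℕ) (β : ℕ → ℕ → ℝ) (r : MvPolynomial (Fin 2) ℝ) : Prop :=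
  momentMatrix n β *ᵥ
    (fun d => r.coeff (Finsupp.single 0 d.1.1 + Finsupp.single 1 d.1.2)) = 0

/-- `β` is `p`-pure: `p` has degree at most `n`, and the column relations of `M(n)` are exactly
those recursively derived from `p`, i.e. the relations `(p * s)(X, Y) = 0` with
`deg (p * s) ≤ n`. -/
def IsPure (n : ℕ) (β : ℕ → ℕ → ℝ) (p : MvPolynomial (Fin 2) ℝ) : Prop :=
  p.totalDegree ≤ n ∧
    ∀ r : MvPolynomial (Fin 2) ℝ, r.totalDegree ≤ n →
      (ColumnRelation n β r ↔ ∃ s, r = p * s)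

/-! ### The curve -/

/-- The polynomial `x y - ∑ q_s x ^ s`, `0 ≤ s ≤ 4`. -/
def curvePoly (q : Fin 5 → ℝ) : MvPolynomial (Fin 2) ℝ :=
  MvPolynomial.X 0 * MvPolynomial.X 1 -
    ∑ s : Fin 5, MvPolynomial.C (q s) * MvPolynomial.X 0 ^ (s : ℕ)

/-- The number `q_{j,t}`, for `-j ≤ t ≤ 3j`: the coefficient of `x ^ t` in the Laurent polynomial
`(∑ q_s x ^ (s - 1)) ^ j`, i.e. the coefficient of `x ^ (t + j)` in `(∑ q_s x ^ s) ^ j`. -/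
def qCoeff (q : Fin 5 → ℝ) (j : ℕ) (t : ℤ) : ℝ :=
  ((∑ s : Fin 5, Polynomial.C (q s) * Polynomial.X ^ (s : ℕ)) ^ j).coeff (t + j).toNat

/-! ### The associated univariate sequence `γ`

`γ_s`, `-2n ≤ s ≤ 6n`, has the free moments `γ_{6n-3} = t₁`, `γ_{6n-1} = t₂`, `γ_{6n} = t₃`.
All other `γ_s` are defined successively, row by row, in the order
`γ_0, …, γ_{2n}` (row `0`), `γ_{-k}, γ_{2n+2k-1}, γ_{2n+2k}` (row `k`, `1 ≤ k ≤ 2n-2`),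
`γ_{-2n+1}, γ_{6n-2}` (row `2n-1`), `γ_{-2n}` (row `2n`). -/

/-- The free moments and row `0`, where `γ_s = β_{s,0}`; the moments which are not yet defined
are set to `0`. -/
def gammaInit (n : ℕ) (β : ℕ → ℕ → ℝ) (t₁ t₂ t₃ : ℝ) : ℤ → ℝ := fun s =>
  if s = 6 * n - 3 then t₁
  else if s = 6 * n - 1 then t₂
  else if s = 6 * n then t₃
  else if 0 ≤ s ∧ s ≤ 2 * n then β s.toNat 0
  else 0

/-- Row `k ≥ 1`: given a sequence `g` in which the rows before `k` are already defined,
define successively `γ_{-k}` (from `β_{0,k}`), `γ_{2n+2k-1}` (from `β_{2n-k-1,k}`, if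
`k ≤ 2n-2`) and `γ_{2n+2k}` (from `β_{2n-k,k}`, if `k ≤ 2n-1`). -/
def gammaStep (n : ℕ) (q : Fin 5 → ℝ) (β : ℕ → ℕ → ℝ) (k : ℕ) (g : ℤ → ℝ) : ℤ → ℝ :=
  let g₁ : ℤ → ℝ := Function.update g (-(k : ℤ))
    (1 / q 0 ^ k *
      (β 0 k - ∑ t ∈ Finset.Icc (-(k : ℤ) + 1) (3 * k), qCoeff q k t * g t))
  let g₂ : ℤ → ℝ :=
    if k + 2 ≤ 2 * n then
      Function.update g₁ (2 * n + 2 * k - 1)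
        (β (2 * n - k - 1) k -
          ∑ t ∈ Finset.Icc (-(k : ℤ)) (3 * k - 1), qCoeff q k t * g₁ (t + (2 * n - k - 1)))
    else g₁
  if k + 1 ≤ 2 * n then
    Function.update g₂ (2 * n + 2 * k)
      (β (2 * n - k) k -
        ∑ t ∈ Finset.Icc (-(k : ℤ)) (3 * k - 1), qCoeff q k t * g₂ (t + (2 * n - k)))
  else g₂

/-- The sequence after the rows `0, …, k` have been defined. -/
def gammaRows (n : ℕ) (q : Fin 5 → ℝ) (β : ℕ → ℕ → ℝ) (t₁ t₂ t₃ : ℝ) : ℕ → ℤ → ℝ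
  | 0 => gammaInit n β t₁ t₂ t₃
  | k + 1 => gammaStep n q β (k + 1) (gammaRows n q β t₁ t₂ t₃ k)

/-- The sequence `γ(t₁, t₂, t₃)`. -/
def gamma (n : ℕ) (q : Fin 5 → ℝ) (β : ℕ → ℕ → ℝ) (t₁ t₂ t₃ : ℝ) : ℤ → ℝ :=
  gammaRows n q β t₁ t₂ t₃ (2 * n)

/-! ### Hankel matrices and the conditions on the free moments -/

/-- The Hankel matrix `(γ_{i+j})` with rows and columns `T^a, …, T^b`. The full matrix `A_γ` is
`hankel γ (-n) (3n)`, and `hankel γ a b` is its restriction to the rows and columns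
`T^a, …, T^b`. -/
def hankel (γ : ℤ → ℝ) (a b : ℤ) : Matrix (Finset.Icc a b) (Finset.Icc a b) ℝ :=
  Matrix.of fun i j => γ (i + j)

/-- The entries `γ_{i+j}`, `a ≤ i ≤ b`, of the column `T^j`. -/
def hankelCol (γ : ℤ → ℝ) (a b j : ℤ) : Finset.Icc a b → ℝ := fun i => γ (i + j)

/-- The central block is positive definite (it involves neither free nor auxiliary moments). -/
def CentralBlockPosDef (n : ℕ) (γ : ℤ → ℝ) : Prop :=
  (hankel γ (-n + 1) (3 * n - 2)).PosDef

/-- `F₁`, the block with rows and columns `T^{-n+1}, …, T^{3n-1}`. -/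
abbrev blockF₁ (n : ℕ) (γ : ℤ → ℝ) :
    Matrix (Finset.Icc (-n + 1 : ℤ) (3 * n - 1)) (Finset.Icc (-n + 1 : ℤ) (3 * n - 1)) ℝ :=
  hankel γ (-n + 1) (3 * n - 1)

/-- The quadratic polynomial `s ↦ det F₁(s)` in the first free moment has real zeros
`tm ≤ tp`, and `t₁` lies strictly between them (`F₁` does not involve `t₂`, `t₃`). -/
def FirstCondition (n : ℕ) (q : Fin 5 → ℝ) (β : ℕ → ℕ → ℝ) (t₁ t₂ t₃ : ℝ) : Prop :=
  ∃ tm tp : ℝ, tm ≤ tp ∧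
    {s : ℝ | (blockF₁ n (gamma n q β s t₂ t₃)).det = 0} = {tm, tp} ∧
    t₁ ∈ Set.Ioo tm tp

/-- The strict lower bound on `t₃ = γ_{6n}`. Here `A` is the central block,
`c₁ = (γ_{2n}, …, γ_{6n-3})`, `v = (γ_{2n+1}, …, γ_{6n-2})` and `t₂ = γ_{6n-1}`. -/
def SecondCondition (n : ℕ) (γ : ℤ → ℝ) (t₂ t₃ : ℝ) : Prop :=
  let A := hankel γ (-n + 1) (3 * n - 2)
  let c₁ := hankelCol γ (-n + 1) (3 * n - 2) (3 * n - 1)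
  let v := hankelCol γ (-n + 1) (3 * n - 2) (3 * n)
  let w₁ : ℝ := γ (6 * n - 2) - c₁ ⬝ᵥ (A⁻¹ *ᵥ c₁)
  t₃ > v ⬝ᵥ ((A⁻¹ + (1 / w₁) • (A⁻¹ * vecMulVec c₁ c₁ * A⁻¹)) *ᵥ v)
      - 2 * t₂ / w₁ * (v ⬝ᵥ (A⁻¹ *ᵥ c₁)) + t₂ ^ 2 / w₁

/-- The strict lower bound on `γ_{-2n}`. Here `B = F₁`, `c₂ = (γ_{2n+1}, …, γ_{6n-2}, γ_{6n-1})`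
and `z₂ = (γ_{-2n+1}, …, γ_{2n-1})`. -/
def ThirdCondition (n : ℕ) (γ : ℤ → ℝ) (t₃ : ℝ) : Prop :=
  let B := blockF₁ n γ
  let c₂ := hankelCol γ (-n + 1) (3 * n - 1) (3 * n)
  let z₂ := hankelCol γ (-n + 1) (3 * n - 1) (-n)
  let w₂ : ℝ := t₃ - c₂ ⬝ᵥ (B⁻¹ *ᵥ c₂)
  γ (-2 * n) > z₂ ⬝ᵥ ((B⁻¹ + (1 / w₂) • (B⁻¹ * vecMulVec c₂ c₂ * B⁻¹)) *ᵥ z₂)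
      - 2 * γ (2 * n) / w₂ * (z₂ ⬝ᵥ (B⁻¹ *ᵥ c₂)) + γ (2 * n) ^ 2 / w₂

end QuarticTMP

end

/-! Since `q 0 ≠ 0`, no point of the curve has `x = 0`, so the curve is the graph `y = P(x)/x` over
the nonzero reals, with `P` the quartic. A measure on it is a measure on the punctured line, and `β
i j` becomes the integral of `x^i (P/x)^j`, a combination of Laurent moments `γ_s` with `-2n ≤ s ≤
6n`. Two things are needed.

The sequence `γ` must reproduce `β` (`beta_eq_laurentFunctional`). For `i = 0` and for `i + j ∈
{2n-1, 2n}` this is how `γ` was defined; the other cases follow by induction on `j` from the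
recursion that purity imposes on `β`.

The sequence `γ` must have a representing measure without atom at `0`. The three conditions say that
the Schur complements are positive when the central block is bordered by the indices `3n-1`, `3n`
and `-n` in turn, so the full Hankel matrix is positive definite (`hankel_posDef`). Diagonalizing it
simultaneously with its shift gives a Gauss quadrature; one further moment may be chosen freely, and
a suitable choice makes all nodes nonzero (`exists_laurent_atoms`). Lifting the nodes to the curve
gives the measure. -/

noncomputable section

namespace QuarticTMP

/-! ### Bordered matrices -/

section Bordered

variable {ι : Type*} [Fintype ι]

/-- The symmetric matrix obtained from `A` by adding the border `c` and the corner `d`. -/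
def bordered (A : Matrix ι ι ℝ) (c : ι → ℝ) (d : ℝ) : Matrix (ι ⊕ Unit) (ι ⊕ Unit) ℝ :=
  fromBlocks A (replicateCol Unit c) (replicateRow Unit c) (of fun _ _ => d)

lemma bordered_mulVec (A : Matrix ι ι ℝ) (c : ι → ℝ) (d : ℝ) (v : ι → ℝ) (t : ℝ) :
    bordered A c d *ᵥ Sum.elim v (fun _ => t) =
      Sum.elim (A *ᵥ v + t • c) (fun _ => c ⬝ᵥ v + d * t) := by
  rw [bordered, fromBlocks_mulVec]
  ext (i | i) <;> simp [mulVec, dotProduct, replicateCol, replicateRow, mul_comm]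

lemma dotProduct_sumElim (v v' : ι → ℝ) (t t' : ℝ) :
    Sum.elim v (fun _ : Unit => t) ⬝ᵥ Sum.elim v' (fun _ => t') = v ⬝ᵥ v' + t * t' := by
  simp [dotProduct]

lemma dotProduct_mulVec_comm_of_isHermitian {A : Matrix ι ι ℝ} (hA : A.IsHermitian)
    (u v : ι → ℝ) : u ⬝ᵥ (A *ᵥ v) = v ⬝ᵥ (A *ᵥ u) := by
  have h : Aᵀ = A := by simpa [IsHermitian] using hA
  rw [dotProduct_comm, ← h, mulVec_transpose, ← dotProduct_mulVec, h]

variable [DecidableEq ι]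

lemma mulVec_inv_mulVec {A : Matrix ι ι ℝ} (hA : A.PosDef) (v : ι → ℝ) :
    A *ᵥ (A⁻¹ *ᵥ v) = v := by
  rw [mulVec_mulVec, mul_nonsing_inv _ ((isUnit_iff_isUnit_det A).1 hA.isUnit), one_mulVec]

lemma inv_mulVec_mulVec {A : Matrix ι ι ℝ} (hA : A.PosDef) (v : ι → ℝ) :
    A⁻¹ *ᵥ (A *ᵥ v) = v := by
  rw [mulVec_mulVec, nonsing_inv_mul _ ((isUnit_iff_isUnit_det A).1 hA.isUnit), one_mulVec]

/-- Completing the square: with `u = v + t A⁻¹c` the quadratic form is `uᵀAu` plus `t²` times the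
Schur complement. -/
theorem bordered_posDef {A : Matrix ι ι ℝ} (hA : A.PosDef) {c : ι → ℝ} {d : ℝ}
    (h : 0 < d - c ⬝ᵥ (A⁻¹ *ᵥ c)) : (bordered A c d).PosDef := by
  refine PosDef.of_dotProduct_mulVec_pos ?_ fun x hx => ?_
  · have hA' : Aᴴ = A := hA.isHermitian
    rw [IsHermitian, bordered, fromBlocks_conjTranspose, hA']
    congr 1
  · obtain ⟨v, t, rfl⟩ : ∃ (v : ι → ℝ) (t : ℝ), x = Sum.elim v (fun _ => t) :=
      ⟨x ∘ Sum.inl, x (Sum.inr ()), by ext (i | i) <;> rfl⟩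
    rw [star_trivial, bordered_mulVec, dotProduct_sumElim]
    set u := v + t • (A⁻¹ *ᵥ c) with hu
    have key : v ⬝ᵥ (A *ᵥ v + t • c) + t * (c ⬝ᵥ v + d * t) =
        u ⬝ᵥ (A *ᵥ u) + t ^ 2 * (d - c ⬝ᵥ (A⁻¹ *ᵥ c)) := by
      have h1 := dotProduct_mulVec_comm_of_isHermitian hA.isHermitian (A⁻¹ *ᵥ c) v
      rw [mulVec_inv_mulVec hA] at h1
      simp only [hu, mulVec_add, mulVec_smul, mulVec_inv_mulVec hA, dotProduct_add,
        add_dotProduct, smul_dotProduct, dotProduct_smul, smul_eq_mul, h1,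
        dotProduct_comm c v, dotProduct_comm c (A⁻¹ *ᵥ c)]
      ring
    rw [key]
    by_cases ht : t = 0
    · have hv : v ≠ 0 := by
        rintro rfl
        apply hx
        ext (i | i) <;> simp [ht]
      have := hA.dotProduct_mulVec_pos hv
      simpa [hu, ht] using this
    · have h0 := hA.posSemidef.dotProduct_mulVec_nonneg u
      rw [star_trivial] at h0
      have : 0 < t ^ 2 * (d - c ⬝ᵥ (A⁻¹ *ᵥ c)) := by positivity
      linarith

theorem det_bordered {A : Matrix ι ι ℝ} (hA : A.PosDef) (c : ι → ℝ) (d : ℝ) :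
    (bordered A c d).det = A.det * (d - c ⬝ᵥ (A⁻¹ *ᵥ c)) := by
  have := hA.isUnit.invertible
  rw [bordered, det_fromBlocks₁₁, det_unique (n := Unit), invOf_eq_nonsing_inv, Matrix.mul_assoc]
  simp [Matrix.mul_apply, dotProduct, mulVec]

/-- The right-hand side is the shape of the lower bounds in `SecondCondition` and `ThirdCondition`;
they are thus Schur complement inequalities for a matrix bordered once more. -/
theorem bordered_inv_form {A : Matrix ι ι ℝ} (hA : A.PosDef) {c : ι → ℝ} {d w : ℝ}
    (hw : w = d - c ⬝ᵥ (A⁻¹ *ᵥ c)) (h : 0 < w) (v : ι → ℝ) (t : ℝ) :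
    Sum.elim v (fun _ => t) ⬝ᵥ ((bordered A c d)⁻¹ *ᵥ Sum.elim v (fun _ => t)) =
      v ⬝ᵥ ((A⁻¹ + (1 / w) • (A⁻¹ * vecMulVec c c * A⁻¹)) *ᵥ v)
        - 2 * t / w * (v ⬝ᵥ (A⁻¹ *ᵥ c)) + t ^ 2 / w := by
  have hB := bordered_posDef hA (hw ▸ h)
  have hAinv : A⁻¹.IsHermitian := hA.inv.isHermitian
  -- The last coordinate of the solution of the bordered linear system, by block elimination.
  set s := (t - c ⬝ᵥ (A⁻¹ *ᵥ v)) / w with hs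
  have hcv := dotProduct_mulVec_comm_of_isHermitian hAinv c v
  have hsol : (bordered A c d)⁻¹ *ᵥ Sum.elim v (fun _ => t) =
      Sum.elim (A⁻¹ *ᵥ v - s • (A⁻¹ *ᵥ c)) (fun _ => s) := by
    rw [← inv_mulVec_mulVec hB (Sum.elim (A⁻¹ *ᵥ v - s • (A⁻¹ *ᵥ c)) (fun _ => s)),
      bordered_mulVec]
    congr 2
    · simp [mulVec_sub, mulVec_smul, mulVec_inv_mulVec hA]
    · ext
      have : s * w = t - c ⬝ᵥ (A⁻¹ *ᵥ v) := by rw [hs]; field_simp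
      simp only [dotProduct_sub, dotProduct_smul, smul_eq_mul]
      rw [hw] at this
      linarith
  have hrank : v ⬝ᵥ ((A⁻¹ * vecMulVec c c * A⁻¹) *ᵥ v) = (v ⬝ᵥ (A⁻¹ *ᵥ c)) ^ 2 := by
    rw [← mulVec_mulVec, ← mulVec_mulVec, vecMulVec_mulVec, op_smul_eq_smul, mulVec_smul,
      dotProduct_smul, hcv, smul_eq_mul, sq]
  rw [hsol, dotProduct_sumElim, add_mulVec, smul_mulVec, dotProduct_add, dotProduct_smul, hrank,
    dotProduct_sub, dotProduct_smul, hs, hcv]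
  simp only [smul_eq_mul]
  field_simp
  ring

variable {κ : Type*}

theorem posDef_of_submatrix_eq_bordered {A : Matrix ι ι ℝ} (hA : A.PosDef) {c : ι → ℝ} {d : ℝ}
    (h : 0 < d - c ⬝ᵥ (A⁻¹ *ᵥ c)) {M : Matrix κ κ ℝ} (e : ι ⊕ Unit ≃ κ)
    (hM : M.submatrix e e = bordered A c d) : M.PosDef := by
  have := (hM ▸ bordered_posDef hA h).submatrix e.symm.injective
  simpa using this

variable [Fintype κ] [DecidableEq κ]

theorem inv_form_of_submatrix_eq_bordered {A : Matrix ι ι ℝ} (hA : A.PosDef) {c : ι → ℝ}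
    {d w : ℝ} (hw : w = d - c ⬝ᵥ (A⁻¹ *ᵥ c)) (h : 0 < w) {M : Matrix κ κ ℝ} (e : ι ⊕ Unit ≃ κ)
    (hM : M.submatrix e e = bordered A c d) {x : κ → ℝ} {v : ι → ℝ} {t : ℝ}
    (hx : x ∘ e = Sum.elim v (fun _ => t)) :
    x ⬝ᵥ (M⁻¹ *ᵥ x) = v ⬝ᵥ ((A⁻¹ + (1 / w) • (A⁻¹ * vecMulVec c c * A⁻¹)) *ᵥ v)
        - 2 * t / w * (v ⬝ᵥ (A⁻¹ *ᵥ c)) + t ^ 2 / w := by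
  rw [← bordered_inv_form hA hw h, ← hM, inv_submatrix_equiv, ← hx, submatrix_mulVec_equiv]
  rw [Function.comp_assoc, Equiv.self_comp_symm, Function.comp_id, comp_equiv_dotProduct_comp_equiv]

theorem det_of_submatrix_eq_bordered {A : Matrix ι ι ℝ} (hA : A.PosDef) {c : ι → ℝ}
    {d : ℝ} {M : Matrix κ κ ℝ} (e : ι ⊕ Unit ≃ κ) (hM : M.submatrix e e = bordered A c d) :
    M.det = A.det * (d - c ⬝ᵥ (A⁻¹ *ᵥ c)) := by
  rw [← det_bordered hA, ← hM, det_submatrix_equiv_self]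

end Bordered

/-! ### Enlarged Hankel matrices as bordered matrices. -/

/-- Adding one point above an integer interval. -/
def iccSumTop (a b b' : ℤ) (hab : a ≤ b') (hb : b' = b + 1) :
    Finset.Icc a b ⊕ Unit ≃ Finset.Icc a b' where
  toFun := Sum.elim (fun i => ⟨i, by have := Finset.mem_Icc.1 i.2; rw [Finset.mem_Icc]; omega⟩)
    (fun _ => ⟨b', by rw [Finset.mem_Icc]; omega⟩)
  invFun i := if h : (i : ℤ) = b' then Sum.inr ()
    else Sum.inl ⟨i, by have := Finset.mem_Icc.1 i.2; rw [Finset.mem_Icc]; omega⟩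
  left_inv := by
    rintro (i | i)
    · have := Finset.mem_Icc.1 i.2
      have h : (i : ℤ) ≠ b' := by omega
      simp [h]
    · simp
  right_inv i := by
    by_cases h : (i : ℤ) = b'
    · ext; simp [h]
    · simp [h]

/-- Adding one point below an integer interval. -/
def iccSumBot (a a' b : ℤ) (hab : a' ≤ b) (ha : a = a' + 1) :
    Finset.Icc a b ⊕ Unit ≃ Finset.Icc a' b where
  toFun := Sum.elim (fun i => ⟨i, by have := Finset.mem_Icc.1 i.2; rw [Finset.mem_Icc]; omega⟩)
    (fun _ => ⟨a', by rw [Finset.mem_Icc]; omega⟩)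
  invFun i := if h : (i : ℤ) = a' then Sum.inr ()
    else Sum.inl ⟨i, by have := Finset.mem_Icc.1 i.2; rw [Finset.mem_Icc]; omega⟩
  left_inv := by
    rintro (i | i)
    · have := Finset.mem_Icc.1 i.2
      have h : (i : ℤ) ≠ a' := by omega
      simp [h]
    · simp
  right_inv i := by
    by_cases h : (i : ℤ) = a'
    · ext; simp [h]
    · simp [h]

lemma hankel_submatrix_iccSumTop (γ : ℤ → ℝ) (a b b' : ℤ) (hab : a ≤ b') (hb : b' = b + 1) :
    (hankel γ a b').submatrix (iccSumTop a b b' hab hb) (iccSumTop a b b' hab hb) =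
      bordered (hankel γ a b) (hankelCol γ a b b') (γ (b' + b')) := by
  ext (i | i) (j | j) <;> simp [hankel, hankelCol, iccSumTop, bordered, add_comm]

lemma hankel_submatrix_iccSumBot (γ : ℤ → ℝ) (a a' b : ℤ) (hab : a' ≤ b) (ha : a = a' + 1) :
    (hankel γ a' b).submatrix (iccSumBot a a' b hab ha) (iccSumBot a a' b hab ha) =
      bordered (hankel γ a b) (hankelCol γ a b a') (γ (a' + a')) := by
  ext (i | i) (j | j) <;> simp [hankel, hankelCol, iccSumBot, bordered, add_comm]

lemma hankelCol_comp_iccSumTop (γ : ℤ → ℝ) (a b b' j : ℤ) (hab : a ≤ b') (hb : b' = b + 1) :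
    hankelCol γ a b' j ∘ iccSumTop a b b' hab hb =
      Sum.elim (hankelCol γ a b j) (fun _ => γ (b' + j)) := by
  ext (i | i) <;> simp [hankelCol, iccSumTop]

/-! ### Truncated Hamburger moment sequences with positive definite Hankel matrix -/

open scoped MatrixOrder in
/-- Simultaneous diagonalization of a positive definite and a symmetric matrix. -/
theorem exists_simultaneous_diagonalization {ι : Type*} [Fintype ι] [DecidableEq ι]
    {H K : Matrix ι ι ℝ} (hH : H.PosDef) (hK : K.IsHermitian) :
    ∃ (G : Matrix ι ι ℝ) (l : ι → ℝ), IsUnit G ∧ H = Gᵀ * G ∧ K = Gᵀ * diagonal l * G := by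
  obtain ⟨R, hR⟩ := CStarAlgebra.nonneg_iff_eq_star_mul_self.mp hH.posSemidef.nonneg
  have hR' : H = Rᵀ * R := by simpa [star_eq_conjTranspose] using hR
  have hdet : IsUnit R.det := by
    have := (isUnit_iff_isUnit_det H).1 hH.isUnit
    rw [hR', det_mul] at this
    exact isUnit_of_mul_isUnit_right this
  have hS : ((R⁻¹)ᵀ * K * R⁻¹).IsHermitian := by
    have hK' : Kᵀ = K := by simpa [IsHermitian] using hK
    simp [IsHermitian, Matrix.mul_assoc, hK']
  have hspec := hS.spectral_theorem
  set U : Matrix ι ι ℝ := (hS.eigenvectorUnitary : Matrix ι ι ℝ) with hU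
  have hUU : U * Uᵀ = 1 := by
    have := Unitary.coe_mul_star_self hS.eigenvectorUnitary
    simpa [star_eq_conjTranspose] using this
  have hspec' : (R⁻¹)ᵀ * K * R⁻¹ = U * diagonal hS.eigenvalues * Uᵀ := by
    rw [Unitary.conjStarAlgAut_apply] at hspec
    simpa [star_eq_conjTranspose] using hspec
  have h1 : R⁻¹ * R = 1 := nonsing_inv_mul _ hdet
  have h2 : Rᵀ * (R⁻¹)ᵀ = 1 := by rw [← transpose_mul, h1, transpose_one]
  -- Here `H = RᵀR`, and the orthogonal `U` diagonalizes the congruent matrix `R⁻ᵀ K R⁻¹`.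
  refine ⟨Uᵀ * R, hS.eigenvalues, ?_, ?_, ?_⟩
  · rw [isUnit_iff_isUnit_det, det_mul]
    refine IsUnit.mul ?_ hdet
    have : IsUnit (U * Uᵀ).det := by simp [hUU]
    rw [det_mul] at this
    exact isUnit_of_mul_isUnit_right this
  · rw [transpose_mul, transpose_transpose, Matrix.mul_assoc, ← Matrix.mul_assoc U, hUU,
      Matrix.one_mul, hR']
  · have hdiag : Rᵀ * (U * diagonal hS.eigenvalues * Uᵀ) * R =
        (Uᵀ * R)ᵀ * diagonal hS.eigenvalues * (Uᵀ * R) := by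
      rw [transpose_mul, transpose_transpose]; simp only [Matrix.mul_assoc]
    rw [← hdiag, ← hspec']
    calc K = (Rᵀ * (R⁻¹)ᵀ) * K * (R⁻¹ * R) := by rw [h1, h2, Matrix.one_mul, Matrix.mul_one]
      _ = Rᵀ * ((R⁻¹)ᵀ * K * R⁻¹) * R := by simp only [Matrix.mul_assoc]

/-- The Hankel matrix `(m_{i+j+s})`, `0 ≤ i, j ≤ N`. -/
def shiftedHankel (N : ℕ) (m : ℕ → ℝ) (s : ℕ) : Matrix (Fin (N + 1)) (Fin (N + 1)) ℝ :=
  of fun i j => m (i + j + s)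

lemma shiftedHankel_isHermitian (N : ℕ) (m : ℕ → ℝ) (s : ℕ) :
    (shiftedHankel N m s).IsHermitian := by
  ext i j
  simp [shiftedHankel, add_comm (i : ℕ)]

lemma shiftedHankel_zero_update (N : ℕ) (m : ℕ → ℝ) (τ : ℝ) :
    shiftedHankel N (Function.update m (2 * N + 1) τ) 0 = shiftedHankel N m 0 := by
  ext i j
  simp only [shiftedHankel, of_apply]
  rw [Function.update_of_ne]
  omega

/-- If moreover the shifted Hankel matrix is invertible, there is a finitely atomic representing
measure with no atom at zero. -/
theorem exists_atoms_of_det_ne_zero {N : ℕ} {m : ℕ → ℝ} (hH : (shiftedHankel N m 0).PosDef)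
    (hK : (shiftedHankel N m 1).det ≠ 0) :
    ∃ x w : Fin (N + 1) → ℝ, (∀ l, x l ≠ 0) ∧ (∀ l, 0 ≤ w l) ∧
      ∀ k ≤ 2 * N, m k = ∑ l, w l * x l ^ k := by
  obtain ⟨G, x, hG, h0, h1⟩ :=
    exists_simultaneous_diagonalization hH (shiftedHankel_isHermitian N m 1)
  have hG' : IsUnit Gᵀ := by
    rw [isUnit_iff_isUnit_det, det_transpose]; exact (isUnit_iff_isUnit_det G).1 hG
  have hshift : ∀ (k : ℕ) (hk : k < N), ∀ l,
      G l ⟨k + 1, by omega⟩ = x l * G l ⟨k, by omega⟩ := by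
    intro k hk l
    -- Column `k + 1` of the Hankel matrix is column `k` of its shift. Cancelling `Gᵀ` shows that
    -- `G` is a Vandermonde matrix with scaled rows; its nodes are the eigenvalues `x l`, and the
    -- squared scalings are the weights.
    have hvec : Gᵀ *ᵥ (fun l => G l ⟨k + 1, by omega⟩) =
        Gᵀ *ᵥ (fun l => x l * G l ⟨k, by omega⟩) := by
      ext i
      have e0 := congrFun (congrFun h0 i) ⟨k + 1, by omega⟩
      have e1 := congrFun (congrFun h1 i) ⟨k, by omega⟩
      rw [Matrix.mul_assoc, Matrix.mul_apply] at e1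
      rw [Matrix.mul_apply] at e0
      simp only [shiftedHankel, of_apply, diagonal_mul, add_zero, transpose_apply] at e0 e1
      simp only [mulVec, dotProduct, transpose_apply]
      rw [← e0, ← e1]
      rfl
    exact congrFun (mulVec_injective_iff_isUnit.2 hG' hvec) l
  have hpow : ∀ (k : ℕ) (hk : k ≤ N) (l), G l ⟨k, by omega⟩ = x l ^ k * G l 0 := by
    intro k
    induction k with
    | zero => intro _ l; simp
    | succ k ih =>
      intro hk l
      rw [hshift k (by omega), ih (by omega)]
      ring
  refine ⟨x, fun l => G l 0 ^ 2, fun l hl => hK ?_, fun l => sq_nonneg _, fun k hk => ?_⟩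
  · rw [h1, det_mul, det_mul, det_diagonal, Finset.prod_eq_zero (Finset.mem_univ l) hl]
    simp
  · obtain ⟨i, j, hi, hj, rfl⟩ : ∃ i j, i ≤ N ∧ j ≤ N ∧ k = i + j :=
      ⟨min k N, k - min k N, by omega, by omega, by omega⟩
    have e0 := congrFun (congrFun h0 ⟨i, by omega⟩) ⟨j, by omega⟩
    simp only [shiftedHankel, of_apply, Matrix.mul_apply, add_zero, transpose_apply] at e0
    rw [e0]
    refine Finset.sum_congr rfl fun l _ => ?_
    rw [hpow i hi, hpow j hj]
    ring

/-- Vectors `f` in the kernel of the shifted Hankel matrix have a nonzero last entry. -/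
lemma last_ne_zero_of_shiftedHankel_mulVec_eq_zero {N : ℕ} {m : ℕ → ℝ}
    (hH : (shiftedHankel N m 0).PosDef) {f : Fin (N + 1) → ℝ} (hf : f ≠ 0)
    (h : shiftedHankel N m 1 *ᵥ f = 0) : f (Fin.last N) ≠ 0 := by
  intro hlast
  -- If `f` is read as a polynomial, `g` is `x f`: with vanishing top coefficient it still has
  -- degree at most `N`, and the Hankel matrix maps it to the shifted matrix times `f`.
  let g : Fin (N + 1) → ℝ := Fin.cons 0 fun i => f i.castSucc
  have hg : shiftedHankel N m 0 *ᵥ g = 0 := by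
    ext i
    have := congrFun h i
    simp only [mulVec, dotProduct, shiftedHankel, of_apply, Pi.zero_apply] at this ⊢
    rw [Fin.sum_univ_castSucc, hlast, mul_zero, add_zero] at this
    rw [Fin.sum_univ_succ]
    simp only [g, Fin.cons_zero, Fin.cons_succ, mul_zero, zero_add, add_zero]
    rw [← this]
    simp [add_assoc]
  have hg0 : g = 0 := mulVec_injective_iff_isUnit.2 hH.isUnit (by rw [hg, mulVec_zero])
  apply hf
  ext i
  refine Fin.lastCases hlast (fun i => ?_) i
  simpa [g] using congrFun hg0 i.succ

/-- At most one extension of the moment sequence makes the shifted Hankel matrix singular. -/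
theorem exists_extension_det_ne_zero {N : ℕ} {m : ℕ → ℝ} (hH : (shiftedHankel N m 0).PosDef) :
    ∃ τ : ℝ, (shiftedHankel N (Function.update m (2 * N + 1) τ) 1).det ≠ 0 := by
  by_contra! hcon
  set K : ℝ → Matrix (Fin (N + 1)) (Fin (N + 1)) ℝ :=
    fun τ => shiftedHankel N (Function.update m (2 * N + 1) τ) 1 with hKdef
  have hH' : ∀ τ, (shiftedHankel N (Function.update m (2 * N + 1) τ) 0).PosDef := by
    intro τ
    rwa [shiftedHankel_zero_update]
  obtain ⟨f, hf, hKf⟩ := exists_mulVec_eq_zero_iff.2 (hcon 0)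
  obtain ⟨g, hg, hKg⟩ := exists_mulVec_eq_zero_iff.2 (hcon 1)
  have hf' := last_ne_zero_of_shiftedHankel_mulVec_eq_zero (hH' 0) hf hKf
  have hg' := last_ne_zero_of_shiftedHankel_mulVec_eq_zero (hH' 1) hg hKg
  -- The new moment enters only the corner. Pairing kernel vectors `f` of `K 0` and `g` of `K 1`
  -- then leaves the product of their last entries, which would have to be zero.
  have hdiff : K 1 = K 0 + single (Fin.last N) (Fin.last N) 1 := by
    ext i j
    simp only [hKdef, shiftedHankel, of_apply, Matrix.add_apply]
    by_cases h : i = Fin.last N ∧ j = Fin.last N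
    · obtain ⟨rfl, rfl⟩ := h
      simp [two_mul]
    · have hij : (i : ℕ) + j + 1 ≠ 2 * N + 1 := by
        intro hij
        exact h ⟨Fin.ext (by rw [Fin.val_last]; omega), Fin.ext (by rw [Fin.val_last]; omega)⟩
      have h' : ¬(Fin.last N = i ∧ Fin.last N = j) := fun h' => h ⟨h'.1.symm, h'.2.symm⟩
      rw [Function.update_of_ne hij, Function.update_of_ne hij, single_apply, if_neg h', add_zero]
  have h0 : f ⬝ᵥ (K 0 *ᵥ g) = 0 := by
    rw [dotProduct_mulVec_comm_of_isHermitian (shiftedHankel_isHermitian _ _ _), hKf,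
      dotProduct_zero]
  have h1 : f ⬝ᵥ (K 1 *ᵥ g) = 0 := by rw [hKg, dotProduct_zero]
  rw [hdiff, add_mulVec, dotProduct_add, h0, zero_add, single_mulVec, one_mul] at h1
  change f ⬝ᵥ Pi.single (Fin.last N) (g (Fin.last N)) = 0 at h1
  rw [dotProduct_single] at h1
  exact mul_ne_zero hf' hg' h1

/-- A sequence with positive definite Hankel matrix has a finitely atomic representing measure
with no atom at zero. -/
theorem exists_nonzero_atoms {N : ℕ} {m : ℕ → ℝ} (hH : (shiftedHankel N m 0).PosDef) :
    ∃ x w : Fin (N + 1) → ℝ, (∀ l, x l ≠ 0) ∧ (∀ l, 0 ≤ w l) ∧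
      ∀ k ≤ 2 * N, m k = ∑ l, w l * x l ^ k := by
  obtain ⟨τ, hτ⟩ := exists_extension_det_ne_zero hH
  have hH' : (shiftedHankel N (Function.update m (2 * N + 1) τ) 0).PosDef := by
    rwa [shiftedHankel_zero_update]
  obtain ⟨x, w, hx, hw, h⟩ := exists_atoms_of_det_ne_zero hH' hτ
  refine ⟨x, w, hx, hw, fun k hk => ?_⟩
  rw [← h k hk, Function.update_of_ne]
  omega

/-- The strong (two-sided) version: a sequence `γ_s`, `-2n ≤ s ≤ 6n`, with positive definite Hankel
matrix is represented by a finitely atomic measure on `ℝ \ {0}`. -/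
theorem exists_laurent_atoms {n : ℕ} {γ : ℤ → ℝ} (h : (hankel γ (-n) (3 * n)).PosDef) :
    ∃ x w : Fin (4 * n + 1) → ℝ, (∀ l, x l ≠ 0) ∧ (∀ l, 0 ≤ w l) ∧
      ∀ s : ℤ, -2 * n ≤ s → s ≤ 6 * n → γ s = ∑ l, w l * x l ^ s := by
  have hH : (shiftedHankel (4 * n) (fun k => γ (k - 2 * n)) 0).PosDef := by
    let e : Fin (4 * n + 1) → Finset.Icc (-n : ℤ) (3 * n) :=
      fun i => ⟨(i : ℤ) - n, by rw [Finset.mem_Icc]; omega⟩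
    have he : Function.Injective e := by
      intro i j hij
      have := congrArg Subtype.val hij
      simp only [e] at this
      ext
      omega
    convert! h.submatrix he using 1
    ext i j
    simp only [shiftedHankel, hankel, of_apply, submatrix_apply, e]
    congr 1
    push_cast
    ring
  obtain ⟨x, w, hx, hw, hxw⟩ := exists_nonzero_atoms hH
  -- The quadrature represents `γ` shifted by `2n`; undoing the shift puts `x^(2n)` into the
  -- weights, and the even exponent keeps them nonnegative.
  refine ⟨x, fun l => w l * x l ^ (2 * n), hx, fun l => ?_, fun s hs hs' => ?_⟩
  · have : 0 ≤ x l ^ (2 * n) := by rw [pow_mul]; positivity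
    have := hw l
    positivity
  · have := hxw (s + 2 * n).toNat (by omega)
    rw [Int.toNat_of_nonneg (by omega), add_sub_cancel_right] at this
    rw [this]
    refine Finset.sum_congr rfl fun l _ => ?_
    rw [← zpow_natCast, Int.toNat_of_nonneg (by omega), zpow_add₀ (hx l)]
    have h1 : x l ^ (2 * n : ℤ) = x l ^ (2 * n) := by exact_mod_cast zpow_natCast (x l) (2 * n)
    rw [h1]
    ring

section Gamma

/-! ### The equations satisfied by `γ` -/

/-- The moment `γ_s` takes its final value in one of the rows `0, …, k`, or it is free. -/
def IsFinal (n k : ℕ) (s : ℤ) : Prop :=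
  (-(k : ℤ) ≤ s ∧ s ≤ 2 * n + 2 * k ∧ s ≤ 6 * n) ∨
    s = 6 * n - 3 ∨ s = 6 * n - 1 ∨ s = 6 * n

variable {n : ℕ} {q : Fin 5 → ℝ} {β : ℕ → ℕ → ℝ}

lemma gammaStep_of_ne {k : ℕ} (g : ℤ → ℝ) {s : ℤ} (h₁ : s ≠ -k)
    (h₂ : k + 2 ≤ 2 * n → s ≠ 2 * n + 2 * k - 1) (h₃ : k + 1 ≤ 2 * n → s ≠ 2 * n + 2 * k) :
    gammaStep n q β k g s = g s := by
  unfold gammaStep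
  split_ifs with h h'
  · rw [Function.update_of_ne (h₃ h), Function.update_of_ne (h₂ h'), Function.update_of_ne h₁]
  · rw [Function.update_of_ne (h₃ h), Function.update_of_ne h₁]
  · rw [Function.update_of_ne (h₂ (by omega)), Function.update_of_ne h₁]
  · rw [Function.update_of_ne h₁]

variable (t₁ t₂ t₃ : ℝ)

/-- The guards in `gammaStep` skip exactly the free indices `6n-3`, `6n-1` and `6n`, so no row
overwrites an earlier value. -/
lemma gammaRows_succ_of_isFinal {k : ℕ} (hk : k + 1 ≤ 2 * n) {s : ℤ} (hs : IsFinal n k s) :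
    gammaRows n q β t₁ t₂ t₃ (k + 1) s = gammaRows n q β t₁ t₂ t₃ k s := by
  rw [gammaRows]
  unfold IsFinal at hs
  apply gammaStep_of_ne <;> push_cast <;> omega

lemma gamma_eq_gammaRows {k : ℕ} (hk : k ≤ 2 * n) {s : ℤ} (hs : IsFinal n k s) :
    gamma n q β t₁ t₂ t₃ s = gammaRows n q β t₁ t₂ t₃ k s := by
  unfold gamma
  suffices ∀ j, k ≤ j → j ≤ 2 * n →
      gammaRows n q β t₁ t₂ t₃ j s = gammaRows n q β t₁ t₂ t₃ k s from this _ hk le_rfl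
  intro j hj
  induction j, hj using Nat.le_induction with
  | base => intro _; rfl
  | succ j hj ih =>
    intro hj'
    rw [← ih (by omega)]
    apply gammaRows_succ_of_isFinal _ _ _ hj'
    unfold IsFinal at *
    omega

lemma gamma_row_zero (hn : 4 ≤ n) {i : ℕ} (hi : i ≤ 2 * n) :
    gamma n q β t₁ t₂ t₃ i = β i 0 := by
  rw [gamma_eq_gammaRows (k := 0) _ _ _ (by omega) (by unfold IsFinal; omega), gammaRows,
    gammaInit, if_neg (by omega), if_neg (by omega), if_neg (by omega), if_pos (by omega)]
  simp

lemma gamma_free (hn : 4 ≤ n) : gamma n q β t₁ t₂ t₃ (6 * n - 3) = t₁ ∧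
    gamma n q β t₁ t₂ t₃ (6 * n - 1) = t₂ ∧ gamma n q β t₁ t₂ t₃ (6 * n) = t₃ := by
  refine ⟨?_, ?_, ?_⟩ <;>
    rw [gamma_eq_gammaRows (k := 0) _ _ _ (by omega) (by unfold IsFinal; omega), gammaRows,
      gammaInit]
  · rw [if_pos rfl]
  · rw [if_neg (by omega), if_pos rfl]
  · rw [if_neg (by omega), if_neg (by omega), if_pos rfl]

/-- All indices on the right are final before row `k`. In the rows `2n-1` and `2n` this holds only
because the free moments are prescribed in advance. -/
lemma gamma_neg (hn : 4 ≤ n) {k : ℕ} (hk : 1 ≤ k) (hk' : k ≤ 2 * n) :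
    gamma n q β t₁ t₂ t₃ (-k) = 1 / q 0 ^ k * (β 0 k -
      ∑ t ∈ Finset.Icc (-(k : ℤ) + 1) (3 * k), qCoeff q k t * gamma n q β t₁ t₂ t₃ t) := by
  obtain ⟨k, rfl⟩ : ∃ j, k = j + 1 := ⟨k - 1, by omega⟩
  rw [gamma_eq_gammaRows _ _ _ hk' (by unfold IsFinal; push_cast; omega), gammaRows]
  have : ∀ t ∈ Finset.Icc (-((k + 1 : ℕ) : ℤ) + 1) (3 * (k + 1 : ℕ)),
      gammaRows n q β t₁ t₂ t₃ k t = gamma n q β t₁ t₂ t₃ t := by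
    intro t ht
    rw [Finset.mem_Icc] at ht
    push_cast at ht
    rw [gamma_eq_gammaRows _ _ _ (by omega : k ≤ 2 * n) (by unfold IsFinal; omega)]
  unfold gammaStep
  rw [Finset.sum_congr rfl fun t ht => by rw [this t ht]]
  split_ifs with h h'
  · rw [Function.update_of_ne (by push_cast; omega), Function.update_of_ne (by push_cast; omega),
      Function.update_self]
  · rw [Function.update_of_ne (by push_cast; omega), Function.update_self]
  · rw [Function.update_of_ne (by push_cast; omega), Function.update_self]
  · rw [Function.update_self]

lemma gamma_odd {k : ℕ} (hk : 1 ≤ k) (hk' : k + 2 ≤ 2 * n) :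
    gamma n q β t₁ t₂ t₃ (2 * n + 2 * k - 1) = β (2 * n - k - 1) k -
      ∑ t ∈ Finset.Icc (-(k : ℤ)) (3 * k - 1),
        qCoeff q k t * gamma n q β t₁ t₂ t₃ (t + (2 * n - k - 1)) := by
  obtain ⟨k, rfl⟩ : ∃ j, k = j + 1 := ⟨k - 1, by omega⟩
  set G := gamma n q β t₁ t₂ t₃ with hG
  have hstep : ∀ s : ℤ, -((k : ℤ) + 1) ≤ s → s ≤ 2 * n + 2 * k + 2 →
      G s = gammaStep n q β (k + 1) (gammaRows n q β t₁ t₂ t₃ k) s := by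
    intro s hs hs'
    rw [hG, gamma_eq_gammaRows (k := k + 1) _ _ _ (by omega)
      (by unfold IsFinal; push_cast; omega), gammaRows]
  unfold gammaStep at hstep
  simp only [if_pos hk', if_pos (by omega : k + 1 + 1 ≤ 2 * n)] at hstep
  rw [hstep _ (by push_cast; omega) (by push_cast; omega),
    Function.update_of_ne (by omega), Function.update_self]
  congr 1
  refine Finset.sum_congr rfl fun t ht => ?_
  rw [Finset.mem_Icc] at ht
  push_cast at ht
  rw [hstep _ (by push_cast; omega) (by push_cast; omega),
    Function.update_of_ne (by push_cast; omega), Function.update_of_ne (by push_cast; omega),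
    Function.update_of_ne (by push_cast; omega), Function.update_of_ne (by push_cast; omega)]

lemma gamma_even {k : ℕ} (hk : 1 ≤ k) (hk' : k + 1 ≤ 2 * n) :
    gamma n q β t₁ t₂ t₃ (2 * n + 2 * k) = β (2 * n - k) k -
      ∑ t ∈ Finset.Icc (-(k : ℤ)) (3 * k - 1),
        qCoeff q k t * gamma n q β t₁ t₂ t₃ (t + (2 * n - k)) := by
  obtain ⟨k, rfl⟩ : ∃ j, k = j + 1 := ⟨k - 1, by omega⟩
  set G := gamma n q β t₁ t₂ t₃ with hG
  have hstep : ∀ s : ℤ, -((k : ℤ) + 1) ≤ s → s ≤ 2 * n + 2 * k + 2 →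
      G s = gammaStep n q β (k + 1) (gammaRows n q β t₁ t₂ t₃ k) s := by
    intro s hs hs'
    rw [hG, gamma_eq_gammaRows (k := k + 1) _ _ _ (by omega)
      (by unfold IsFinal; push_cast; omega), gammaRows]
  unfold gammaStep at hstep
  simp only [if_pos hk'] at hstep
  rw [hstep _ (by push_cast; omega) (by push_cast; omega), Function.update_self]
  congr 1
  refine Finset.sum_congr rfl fun t ht => ?_
  rw [Finset.mem_Icc] at ht
  push_cast at ht
  rw [hstep _ (by push_cast; omega) (by push_cast; omega),
    Function.update_of_ne (by push_cast; omega)]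

/-! ### Dependence on the free moments -/

/-- Rows up to `2n-2` read no index beyond `6n-5`, hence no free moment. The range is exactly that
of the entries of the central block. -/
lemma gamma_congr (hn : 4 ≤ n) (s₁ s₂ s₃ : ℝ) {s : ℤ} (hs : -2 * n + 2 ≤ s)
    (hs' : s ≤ 6 * n - 4) : gamma n q β s₁ s₂ s₃ s = gamma n q β t₁ t₂ t₃ s := by
  suffices ∀ k : ℕ, k + 2 ≤ 2 * n → ∀ s : ℤ, -(k : ℤ) ≤ s → s ≤ 2 * n + 2 * k →
      gamma n q β s₁ s₂ s₃ s = gamma n q β t₁ t₂ t₃ s from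
    this (2 * n - 2) (by omega) s (by omega) (by omega)
  intro k
  induction k with
  | zero =>
    intro _ s hs hs'
    lift s to ℕ using by simpa using hs
    rw [gamma_row_zero _ _ _ hn (by omega), gamma_row_zero _ _ _ hn (by omega)]
  | succ k ih =>
    intro hk
    specialize ih (by omega)
    have h1 : gamma n q β s₁ s₂ s₃ (-(k + 1 : ℕ)) = gamma n q β t₁ t₂ t₃ (-(k + 1 : ℕ)) := by
      rw [gamma_neg _ _ _ hn (by omega) (by omega), gamma_neg _ _ _ hn (by omega) (by omega)]
      congr 2
      refine Finset.sum_congr rfl fun t ht => ?_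
      rw [Finset.mem_Icc] at ht
      push_cast at ht
      rw [ih t (by omega) (by omega)]
    have h1' : ∀ s : ℤ, -(k + 1 : ℕ) ≤ s → s ≤ 2 * n + 2 * k →
        gamma n q β s₁ s₂ s₃ s = gamma n q β t₁ t₂ t₃ s := by
      intro s hs hs'
      rcases hs.eq_or_lt with rfl | hs
      · exact h1
      · exact ih s (by push_cast at hs; omega) hs'
    have h2 : gamma n q β s₁ s₂ s₃ (2 * n + 2 * (k + 1 : ℕ) - 1) =
        gamma n q β t₁ t₂ t₃ (2 * n + 2 * (k + 1 : ℕ) - 1) := by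
      rw [gamma_odd _ _ _ (by omega) (by omega), gamma_odd _ _ _ (by omega) (by omega)]
      congr 1
      refine Finset.sum_congr rfl fun t ht => ?_
      rw [Finset.mem_Icc] at ht
      push_cast at ht
      rw [h1' _ (by push_cast; omega) (by push_cast; omega)]
    have h2' : ∀ s : ℤ, -(k + 1 : ℕ) ≤ s → s ≤ 2 * n + 2 * (k + 1 : ℕ) - 1 →
        gamma n q β s₁ s₂ s₃ s = gamma n q β t₁ t₂ t₃ s := by
      intro s hs hs'
      rcases hs'.eq_or_lt with rfl | hs'
      · exact h2
      · exact h1' s hs (by push_cast at hs'; omega)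
    intro s hs hs'
    rcases hs'.eq_or_lt with rfl | hs'
    · rw [gamma_even _ _ _ (by omega) (by omega), gamma_even _ _ _ (by omega) (by omega)]
      congr 1
      refine Finset.sum_congr rfl fun t ht => ?_
      rw [Finset.mem_Icc] at ht
      push_cast at ht
      rw [h2' _ (by push_cast; omega) (by push_cast; omega)]
    · exact h2' s hs (by omega)

/-- The moment `γ_{6n-2}` is an affine function of the first free moment. -/
lemma gamma_affine (hn : 4 ≤ n) (s : ℝ) :
    gamma n q β s t₂ t₃ (6 * n - 2) = gamma n q β t₁ t₂ t₃ (6 * n - 2) -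
      qCoeff q (2 * n - 1) (6 * n - 4) * (s - t₁) := by
  have key : ∀ r, gamma n q β r t₂ t₃ (6 * n - 2) = β 1 (2 * n - 1) -
      ((∑ t ∈ (Finset.Icc (-((2 * n - 1 : ℕ) : ℤ)) (3 * (2 * n - 1 : ℕ) - 1)).erase (6 * n - 4),
        qCoeff q (2 * n - 1) t * gamma n q β t₁ t₂ t₃ (t + 1)) +
      qCoeff q (2 * n - 1) (6 * n - 4) * r) := by
    intro r
    have h := gamma_even (q := q) (β := β) r t₂ t₃ (n := n) (k := 2 * n - 1) (by omega) (by omega)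
    rw [show (2 * n + 2 * (2 * n - 1 : ℕ) : ℤ) = 6 * n - 2 by omega,
      show 2 * n - (2 * n - 1) = 1 by omega,
      show (2 * n - (2 * n - 1 : ℕ) : ℤ) = 1 by omega] at h
    -- Only the top term `t = 6n-4` of this row involves `γ_{6n-3}`; the others are covered by
    -- `gamma_congr`.
    rw [h, ← Finset.sum_erase_add _ _ (a := (6 * n - 4 : ℤ)) (by rw [Finset.mem_Icc]; omega),
      show (6 * n - 4 + 1 : ℤ) = 6 * n - 3 by ring, (gamma_free r t₂ t₃ hn).1]
    congr 2
    refine Finset.sum_congr rfl fun t ht => ?_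
    rw [Finset.mem_erase, Finset.mem_Icc] at ht
    rw [gamma_congr t₁ t₂ t₃ hn r t₂ t₃ (by omega) (by omega)]
  rw [key s, key t₁]
  ring

end Gamma

variable {n : ℕ} {q : Fin 5 → ℝ} {β : ℕ → ℕ → ℝ}

/-! ### Positive definiteness of the full Hankel matrix -/

/-- A concave quadratic is positive between its zeros; eliminating `L` gives `W = -E a b`. -/
lemma pos_of_quadratic_zeros {W L E a b : ℝ} (hE : 0 < E) (ha : a < 0) (hb : 0 < b)
    (h₁ : W - L * a - E * a ^ 2 = 0) (h₂ : W - L * b - E * b ^ 2 = 0) : 0 < W := by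
  have h : (b - a) * (W + E * a * b) = 0 := by linear_combination b * h₁ - a * h₂
  have h' : W + E * a * b = 0 := (mul_eq_zero.1 h).resolve_left (by linarith)
  have : 0 < E * (-a) * b := by have := neg_pos.2 ha; positivity
  linarith

/-- Up to the factor `det A > 0`, `det F₁(s)` is a concave quadratic in `s - t₁`: the corner is
affine in `s`, and only the last entry of the border depends on `s`. Its constant term is the Schur
complement at `t₁`. -/
lemma firstCondition_schur_pos (hn : 4 ≤ n) {t₁ t₂ t₃ : ℝ}
    (hA : CentralBlockPosDef n (gamma n q β t₁ t₂ t₃)) (h : FirstCondition n q β t₁ t₂ t₃) :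
    0 < gamma n q β t₁ t₂ t₃ (6 * n - 2) -
      hankelCol (gamma n q β t₁ t₂ t₃) (-n + 1) (3 * n - 2) (3 * n - 1) ⬝ᵥ
        ((hankel (gamma n q β t₁ t₂ t₃) (-n + 1) (3 * n - 2))⁻¹ *ᵥ
          hankelCol (gamma n q β t₁ t₂ t₃) (-n + 1) (3 * n - 2) (3 * n - 1)) := by
  obtain ⟨tm, tp, -, hzero, htm, htp⟩ := h
  set A := hankel (gamma n q β t₁ t₂ t₃) (-n + 1) (3 * n - 2) with hAdef
  set c := hankelCol (gamma n q β t₁ t₂ t₃) (-n + 1) (3 * n - 2) (3 * n - 1) with hc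
  replace hA : A.PosDef := hA
  let last : Finset.Icc (-n + 1 : ℤ) (3 * n - 2) := ⟨3 * n - 2, by rw [Finset.mem_Icc]; omega⟩
  let e : Finset.Icc (-n + 1 : ℤ) (3 * n - 2) → ℝ := Pi.single last 1
  have he : e ≠ 0 := by simp [e]
  have hE : 0 < e ⬝ᵥ (A⁻¹ *ᵥ e) := by simpa using hA.inv.dotProduct_mulVec_pos he
  have hAs : ∀ s, hankel (gamma n q β s t₂ t₃) (-n + 1) (3 * n - 2) = A := by
    intro s
    ext i j
    have hi := Finset.mem_Icc.1 i.2
    have hj := Finset.mem_Icc.1 j.2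
    simp only [hAdef, hankel, of_apply]
    exact gamma_congr _ _ _ hn _ _ _ (by omega) (by omega)
  have hcs : ∀ s, hankelCol (gamma n q β s t₂ t₃) (-n + 1) (3 * n - 2) (3 * n - 1) =
      c + (s - t₁) • e := by
    intro s
    ext i
    have hi := Finset.mem_Icc.1 i.2
    simp only [hc, hankelCol, Pi.add_apply, Pi.smul_apply, smul_eq_mul, e]
    by_cases h : i = last
    · subst h
      simp only [last, Pi.single_eq_same]
      rw [show (3 * n - 2 + (3 * n - 1) : ℤ) = 6 * n - 3 by ring, (gamma_free s t₂ t₃ hn).1,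
        (gamma_free t₁ t₂ t₃ hn).1]
      ring
    · rw [Pi.single_eq_of_ne h, mul_zero, add_zero]
      have h' : (i : ℤ) ≠ 3 * n - 2 := fun h' => h (Subtype.ext h')
      exact gamma_congr _ _ _ hn _ _ _ (by omega) (by omega)
  have hdet : ∀ s, (blockF₁ n (gamma n q β s t₂ t₃)).det = A.det *
      ((gamma n q β t₁ t₂ t₃ (6 * n - 2) - c ⬝ᵥ (A⁻¹ *ᵥ c)) -
        (qCoeff q (2 * n - 1) (6 * n - 4) + 2 * (c ⬝ᵥ (A⁻¹ *ᵥ e))) * (s - t₁) -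
          e ⬝ᵥ (A⁻¹ *ᵥ e) * (s - t₁) ^ 2) := by
    intro s
    have hs := hankel_submatrix_iccSumTop (gamma n q β s t₂ t₃) (-n + 1) (3 * n - 2) (3 * n - 1)
      (by omega) (by omega)
    rw [hAs, hcs, show (3 * n - 1 + (3 * n - 1) : ℤ) = 6 * n - 2 by ring,
      gamma_affine t₁ t₂ t₃ hn] at hs
    rw [blockF₁, det_of_submatrix_eq_bordered hA _ hs]
    simp only [mulVec_add, mulVec_smul, add_dotProduct, smul_dotProduct, dotProduct_add,
      dotProduct_smul, smul_eq_mul,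
      dotProduct_mulVec_comm_of_isHermitian hA.inv.isHermitian e c]
    ring
  have hz : ∀ s ∈ ({tm, tp} : Set ℝ), (gamma n q β t₁ t₂ t₃ (6 * n - 2) - c ⬝ᵥ (A⁻¹ *ᵥ c)) -
        (qCoeff q (2 * n - 1) (6 * n - 4) + 2 * (c ⬝ᵥ (A⁻¹ *ᵥ e))) * (s - t₁) -
          e ⬝ᵥ (A⁻¹ *ᵥ e) * (s - t₁) ^ 2 = 0 := by
    intro s hs
    rw [← hzero] at hs
    have hs' : (blockF₁ n (gamma n q β s t₂ t₃)).det = 0 := hs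
    rw [hdet] at hs'
    exact (mul_eq_zero.1 hs').resolve_left hA.det_pos.ne'
  exact pos_of_quadratic_zeros hE (sub_neg.2 htm) (sub_pos.2 htp) (hz tm (by simp))
    (hz tp (by simp))

theorem hankel_posDef (hn : 4 ≤ n) {t₁ t₂ t₃ : ℝ}
    (hA : CentralBlockPosDef n (gamma n q β t₁ t₂ t₃)) (h₁ : FirstCondition n q β t₁ t₂ t₃)
    (h₂ : SecondCondition n (gamma n q β t₁ t₂ t₃) t₂ t₃)
    (h₃ : ThirdCondition n (gamma n q β t₁ t₂ t₃) t₃) :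
    (hankel (gamma n q β t₁ t₂ t₃) (-n) (3 * n)).PosDef := by
  have hw₁ := firstCondition_schur_pos hn hA h₁
  obtain ⟨-, hf₂, hf₃⟩ := gamma_free (q := q) (β := β) t₁ t₂ t₃ hn
  set γ := gamma n q β t₁ t₂ t₃
  have e₁ := hankel_submatrix_iccSumTop γ (-n + 1) (3 * n - 2) (3 * n - 1) (by omega) (by omega)
  rw [show (3 * n - 1 + (3 * n - 1) : ℤ) = 6 * n - 2 by ring] at e₁
  have hB : (blockF₁ n γ).PosDef := posDef_of_submatrix_eq_bordered hA hw₁ _ e₁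
  have hw₂ : 0 < γ (6 * n) - hankelCol γ (-n + 1) (3 * n - 1) (3 * n) ⬝ᵥ
      ((blockF₁ n γ)⁻¹ *ᵥ hankelCol γ (-n + 1) (3 * n - 1) (3 * n)) := by
    rw [inv_form_of_submatrix_eq_bordered hA rfl hw₁ _ e₁ (hankelCol_comp_iccSumTop _ _ _ _ _ _ _),
      show (3 * n - 1 + 3 * n : ℤ) = 6 * n - 1 by ring, hf₂, hf₃]
    exact sub_pos.2 h₂
  have e₂ := hankel_submatrix_iccSumTop γ (-n + 1) (3 * n - 1) (3 * n) (by omega) (by omega)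
  rw [show (3 * n + 3 * n : ℤ) = 6 * n by ring] at e₂
  have hF₂ : (hankel γ (-n + 1) (3 * n)).PosDef := posDef_of_submatrix_eq_bordered hB hw₂ _ e₂
  have e₃ := hankel_submatrix_iccSumBot γ (-n + 1) (-n) (3 * n) (by omega) (by omega)
  rw [show (-n + -n : ℤ) = -2 * n by ring] at e₃
  refine posDef_of_submatrix_eq_bordered hF₂ ?_ _ e₃
  rw [inv_form_of_submatrix_eq_bordered hB rfl hw₂ _ e₂ (hankelCol_comp_iccSumTop _ _ _ _ _ _ _),
      show (3 * n + -n : ℤ) = 2 * n by ring, hf₃]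
  exact sub_pos.2 h₃

/-! ### The sequence `β` in terms of `γ` -/

lemma curvePoly_totalDegree_le (q : Fin 5 → ℝ) : (curvePoly q).totalDegree ≤ 4 := by
  unfold curvePoly
  refine (MvPolynomial.totalDegree_sub _ _).trans (max_le ?_ ?_)
  · exact (MvPolynomial.totalDegree_mul _ _).trans (by simp)
  · refine MvPolynomial.totalDegree_finsetSum_le fun s _ => ?_
    refine (MvPolynomial.totalDegree_mul _ _).trans ?_
    simp only [MvPolynomial.totalDegree_C, MvPolynomial.totalDegree_X_pow]
    omega

/-- With purity this forces `n ≥ 4`, which keeps the free indices away from row `0`. -/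
lemma four_le_totalDegree_curvePoly {q : Fin 5 → ℝ} (hq4 : q 4 = 1) :
    4 ≤ (curvePoly q).totalDegree := by
  have hmem : Finsupp.single (0 : Fin 2) 4 ∈ (curvePoly q).support := by
    rw [MvPolynomial.mem_support_iff, curvePoly, MvPolynomial.coeff_sub, MvPolynomial.coeff_sum]
    have h1 : MvPolynomial.coeff (Finsupp.single (0 : Fin 2) 4)
        (MvPolynomial.X 0 * MvPolynomial.X 1 : MvPolynomial (Fin 2) ℝ) = 0 := by
      rw [MvPolynomial.coeff_mul_X', if_neg (by simp)]
    have h0 : (0 : Fin 2 →₀ ℕ) ≠ Finsupp.single 0 4 := by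
      intro h; simpa using DFunLike.congr_fun h 0
    rw [h1, Fin.sum_univ_five]
    simp [MvPolynomial.coeff_C_mul, MvPolynomial.coeff_X_pow, hq4, h0,
      Finsupp.single_eq_single_iff]
  simpa using MvPolynomial.le_totalDegree hmem

/-- The Riesz functional of `β`, shifted by the monomial `x ^ k * y ^ l` and truncated at
degree `n`. -/
def riesz (n : ℕ) (β : ℕ → ℕ → ℝ) (k l : ℕ) (r : MvPolynomial (Fin 2) ℝ) : ℝ :=
  ∑ d : exponents n, β (k + d.1.1) (l + d.1.2) *
    r.coeff (Finsupp.single 0 d.1.1 + Finsupp.single 1 d.1.2)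

lemma riesz_sub (k l : ℕ) (r s : MvPolynomial (Fin 2) ℝ) :
    riesz n β k l (r - s) = riesz n β k l r - riesz n β k l s := by
  simp [riesz, mul_sub]

lemma riesz_sum {ι : Type*} (I : Finset ι) (k l : ℕ) (r : ι → MvPolynomial (Fin 2) ℝ) :
    riesz n β k l (∑ i ∈ I, r i) = ∑ i ∈ I, riesz n β k l (r i) := by
  simp only [riesz, MvPolynomial.coeff_sum, Finset.mul_sum]
  exact Finset.sum_comm

lemma riesz_C_mul (k l : ℕ) (a : ℝ) (r : MvPolynomial (Fin 2) ℝ) :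
    riesz n β k l (MvPolynomial.C a * r) = a * riesz n β k l r := by
  simp only [riesz, MvPolynomial.coeff_C_mul, Finset.mul_sum]
  exact Finset.sum_congr rfl fun _ _ => by ring

lemma riesz_monomial (k l : ℕ) {a b : ℕ} (hab : a + b ≤ n) :
    riesz n β k l (MvPolynomial.X 0 ^ a * MvPolynomial.X 1 ^ b) = β (k + a) (l + b) := by
  have hmem : (a, b) ∈ exponents n := by
    simp only [exponents, Finset.mem_filter, Finset.mem_product, Finset.mem_range]
    omega
  have hmon : (MvPolynomial.X 0 ^ a * MvPolynomial.X 1 ^ b : MvPolynomial (Fin 2) ℝ) =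
      MvPolynomial.monomial (Finsupp.single 0 a + Finsupp.single 1 b) 1 := by
    rw [MvPolynomial.X_pow_eq_monomial, MvPolynomial.X_pow_eq_monomial,
      MvPolynomial.monomial_mul, one_mul]
  rw [riesz, Finset.sum_eq_single ⟨(a, b), hmem⟩]
  · rw [hmon, MvPolynomial.coeff_monomial, if_pos rfl, mul_one]
  · rintro ⟨⟨a', b'⟩, h'⟩ _ hne
    rw [hmon, MvPolynomial.coeff_monomial, if_neg, mul_zero]
    intro heq
    apply hne
    have h0 := DFunLike.congr_fun heq 0
    have h1 := DFunLike.congr_fun heq 1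
    simp at h0 h1
    simp [h0, h1]
  · simp

/-- The recursion for `β` coming from the column relations. -/
theorem IsPure.recursion (hn : 4 ≤ n) (h : IsPure n β (curvePoly q)) {a b : ℕ}
    (hab : a + b + 4 ≤ 2 * n) : β (a + 1) (b + 1) = ∑ s : Fin 5, q s * β (a + s) b := by
  -- The exponent is split between a column relation, `p` times `x^i y^j` of degree at most `n`, and
  -- the row `x^k y^l` in which it is read.
  obtain ⟨i, k, j, l, rfl, rfl, hij, hkl⟩ :
      ∃ i k j l, a = k + i ∧ b = l + j ∧ i + j + 4 ≤ n ∧ k + l ≤ n :=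
    ⟨a - min a n, min a n, b - min b (n - min a n), min b (n - min a n), by omega, by omega,
      by omega, by omega⟩
  set m : MvPolynomial (Fin 2) ℝ := MvPolynomial.X 0 ^ i * MvPolynomial.X 1 ^ j with hm
  have hmdeg : m.totalDegree ≤ i + j :=
    (MvPolynomial.totalDegree_mul _ _).trans (by simp [MvPolynomial.totalDegree_X_pow])
  have hdeg : (curvePoly q * m).totalDegree ≤ n :=
    (MvPolynomial.totalDegree_mul _ _).trans (by have := curvePoly_totalDegree_le q; omega)
  have hcol := (h.2 _ hdeg).2 ⟨m, rfl⟩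
  have hmem : (k, l) ∈ exponents n := by
    simp only [exponents, Finset.mem_filter, Finset.mem_product, Finset.mem_range]
    omega
  have hrow : riesz n β k l (curvePoly q * m) = 0 := congrFun hcol ⟨(k, l), hmem⟩
  have hexp : curvePoly q * m = MvPolynomial.X 0 ^ (i + 1) * MvPolynomial.X 1 ^ (j + 1) -
      ∑ s : Fin 5, MvPolynomial.C (q s) *
        (MvPolynomial.X 0 ^ (i + (s : ℕ)) * MvPolynomial.X 1 ^ j) := by
    rw [curvePoly, hm, sub_mul, Finset.sum_mul]
    congr 1
    · ring
    · exact Finset.sum_congr rfl fun s _ => by ring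
  rw [hexp, riesz_sub, riesz_sum, riesz_monomial _ _ (by omega)] at hrow
  have : ∀ s : Fin 5, riesz n β k l (MvPolynomial.C (q s) *
      (MvPolynomial.X 0 ^ (i + (s : ℕ)) * MvPolynomial.X 1 ^ j)) =
        q s * β (k + (i + s)) (l + j) := by
    intro s
    rw [riesz_C_mul, riesz_monomial _ _ (by omega)]
  simp only [this, ← add_assoc] at hrow
  linarith

/-! ### Laurent functionals and the substitution `y = P(x)/x`. -/

/-- The quartic `∑ q_s x ^ s`. -/
def quartic (q : Fin 5 → ℝ) : Polynomial ℝ :=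
  ∑ s : Fin 5, Polynomial.C (q s) * Polynomial.X ^ (s : ℕ)

/-- The functional `x ^ m ↦ γ_{m+c}` on univariate polynomials. -/
def laurentFunctional (γ : ℤ → ℝ) (c : ℤ) (f : Polynomial ℝ) : ℝ :=
  f.sum fun m a => a * γ (m + c)

lemma laurentFunctional_eq_sum (γ : ℤ → ℝ) (c : ℤ) (f : Polynomial ℝ) {N : ℕ}
    (hf : f.natDegree < N) :
    laurentFunctional γ c f = ∑ m ∈ Finset.range N, f.coeff m * γ (m + c) :=
  Polynomial.sum_over_range' f (by simp) N hf

lemma laurentFunctional_add (γ : ℤ → ℝ) (c : ℤ) (f g : Polynomial ℝ) :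
    laurentFunctional γ c (f + g) = laurentFunctional γ c f + laurentFunctional γ c g :=
  Polynomial.sum_add_index f g _ (by simp) fun _ _ _ => add_mul _ _ _

lemma laurentFunctional_sum {ι : Type*} (I : Finset ι) (γ : ℤ → ℝ) (c : ℤ)
    (f : ι → Polynomial ℝ) :
    laurentFunctional γ c (∑ i ∈ I, f i) = ∑ i ∈ I, laurentFunctional γ c (f i) :=
  map_sum (AddMonoidHom.mk' (laurentFunctional γ c) (laurentFunctional_add γ c)) f I

lemma laurentFunctional_C_mul_X_pow_mul (γ : ℤ → ℝ) (c : ℤ) (a : ℝ) (s : ℕ)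
    (f : Polynomial ℝ) :
    laurentFunctional γ c (Polynomial.C a * Polynomial.X ^ s * f) =
      a * laurentFunctional γ (c + s) f := by
  induction f using Polynomial.induction_on' with
  | add f g hf hg => rw [mul_add, laurentFunctional_add, hf, hg, laurentFunctional_add, mul_add]
  | monomial m b =>
    rw [Polynomial.C_mul_X_pow_eq_monomial, Polynomial.monomial_mul_monomial, laurentFunctional,
      laurentFunctional, Polynomial.sum_monomial_index _ _ (by simp),
      Polynomial.sum_monomial_index _ _ (by simp)]
    push_cast
    rw [show (s + m + c : ℤ) = m + (c + s) by ring]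
    ring

lemma quartic_natDegree_le (q : Fin 5 → ℝ) : (quartic q).natDegree ≤ 4 := by
  refine Polynomial.natDegree_sum_le_of_forall_le _ _ fun s _ => ?_
  exact (Polynomial.natDegree_C_mul_X_pow_le _ _).trans (by omega)

lemma quartic_pow_natDegree_lt (q : Fin 5 → ℝ) (j : ℕ) :
    (quartic q ^ j).natDegree < 4 * j + 1 := by
  have := Polynomial.natDegree_pow_le_of_le j (quartic_natDegree_le q)
  omega

/-- The offset `c - j` accounts for the denominator in `(P/x)^j`. -/
lemma sum_qCoeff_eq_laurentFunctional (γ : ℤ → ℝ) (j : ℕ) (c : ℤ) :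
    ∑ t ∈ Finset.Icc (-(j : ℤ)) (3 * j), qCoeff q j t * γ (t + c) =
      laurentFunctional γ (c - j) (quartic q ^ j) := by
  rw [laurentFunctional_eq_sum _ _ _ (quartic_pow_natDegree_lt q j)]
  symm
  refine Finset.sum_nbij' (fun m => (m : ℤ) - j) (fun t => (t + j).toNat) ?_ ?_ ?_ ?_ ?_
  · intro m hm
    rw [Finset.mem_range] at hm
    rw [Finset.mem_Icc]
    omega
  · intro t ht
    rw [Finset.mem_Icc] at ht
    rw [Finset.mem_range]
    omega
  · intro m _
    simp
  · intro t ht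
    rw [Finset.mem_Icc] at ht
    omega
  · intro m _
    rw [qCoeff, quartic, sub_add_cancel, Int.toNat_natCast,
      show (m - j + c : ℤ) = m + (c - j) by ring]

lemma qCoeff_neg_self (q : Fin 5 → ℝ) (j : ℕ) : qCoeff q j (-j) = q 0 ^ j := by
  rw [qCoeff, neg_add_cancel, Int.toNat_zero, Polynomial.coeff_zero_eq_eval_zero,
    Polynomial.eval_pow, Fin.sum_univ_five]
  simp

lemma qCoeff_three_mul {q : Fin 5 → ℝ} (hq4 : q 4 = 1) (j : ℕ) : qCoeff q j (3 * j) = 1 := by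
  have h := Polynomial.coeff_pow_of_natDegree_le (m := j) (quartic_natDegree_le q)
  have h4 : (quartic q).coeff 4 = 1 := by
    rw [quartic, Fin.sum_univ_five]
    simp [Polynomial.coeff_X_pow, hq4]
  rw [h4, one_pow] at h
  rw [qCoeff, show ((3 * j + j : ℤ)).toNat = j * 4 by omega]
  exact h

/-- Each moment of `β` is the corresponding combination of the `γ_s`. -/
theorem beta_eq_laurentFunctional (hn : 4 ≤ n) (hq0 : q 0 ≠ 0) (hq4 : q 4 = 1)
    (h : IsPure n β (curvePoly q)) (t₁ t₂ t₃ : ℝ) (j : ℕ) :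
    ∀ i, i + j ≤ 2 * n →
      β i j = laurentFunctional (gamma n q β t₁ t₂ t₃) (i - j) (quartic q ^ j) := by
  set γ := gamma n q β t₁ t₂ t₃ with hγ
  have hsplit : ∀ j i : ℕ, laurentFunctional γ (i - j) (quartic q ^ j) =
      ∑ t ∈ Finset.Icc (-(j : ℤ)) (3 * j - 1), qCoeff q j t * γ (t + i) + γ (3 * j + i) := by
    intro j i
    rw [← sum_qCoeff_eq_laurentFunctional, ← Finset.sum_erase_add _ _
      (a := (3 * j : ℤ)) (by rw [Finset.mem_Icc]; omega), qCoeff_three_mul hq4, one_mul]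
    congr 2
    ext t
    rw [Finset.mem_erase, Finset.mem_Icc, Finset.mem_Icc]
    omega
  induction j with
  | zero =>
    intro i hi
    rw [pow_zero, laurentFunctional, ← Polynomial.C_1, Polynomial.sum_C_index (by simp)]
    simp [hγ, gamma_row_zero t₁ t₂ t₃ hn (i := i) (by omega)]
  | succ j ih =>
    intro i hi
    rcases Nat.eq_zero_or_pos i with rfl | hi0
    -- For `i = 0` the defining equation was solved for its lowest term, whose coefficient is
    -- `q_0^(j+1)`; otherwise the top term, with coefficient `1`, is used.
    · have hk := gamma_neg (q := q) (β := β) t₁ t₂ t₃ hn (k := j + 1) (by omega) (by omega)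
      have hne : q 0 ^ (j + 1) ≠ 0 := pow_ne_zero _ hq0
      rw [← sum_qCoeff_eq_laurentFunctional, ← Finset.sum_erase_add _ _
        (a := (-(j + 1 : ℕ) : ℤ)) (by rw [Finset.mem_Icc]; omega), qCoeff_neg_self]
      have hset : (Finset.Icc (-((j + 1 : ℕ) : ℤ)) (3 * (j + 1 : ℕ))).erase (-(j + 1 : ℕ)) =
          Finset.Icc (-((j + 1 : ℕ) : ℤ) + 1) (3 * (j + 1 : ℕ)) := by
        ext t
        rw [Finset.mem_erase, Finset.mem_Icc, Finset.mem_Icc]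
        omega
      simp only [Nat.cast_zero, add_zero]
      rw [hset, hγ, hk]
      field_simp
      ring
    · by_cases h2 : i + (j + 1) = 2 * n
      · have hk := gamma_even (q := q) (β := β) t₁ t₂ t₃ (n := n) (k := j + 1)
          (by omega) (by omega)
        rw [show 2 * n - (j + 1) = i by omega,
          show (2 * n - (j + 1 : ℕ) : ℤ) = i by omega] at hk
        rw [hsplit, show (3 * (j + 1 : ℕ) + i : ℤ) = 2 * n + 2 * (j + 1 : ℕ) by omega, hγ, hk]
        ring
      by_cases h1 : i + (j + 1) = 2 * n - 1
      · have hk := gamma_odd (q := q) (β := β) t₁ t₂ t₃ (n := n) (k := j + 1)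
          (by omega) (by omega)
        rw [show 2 * n - (j + 1) - 1 = i by omega,
          show (2 * n - (j + 1 : ℕ) - 1 : ℤ) = i by omega] at hk
        rw [hsplit, show (3 * (j + 1 : ℕ) + i : ℤ) = 2 * n + 2 * (j + 1 : ℕ) - 1 by omega, hγ,
          hk]
        ring
      -- Now `i ≥ 1` and `i + (j+1) ≤ 2n-2`. The recursion replaces `xy` by a quartic and can raise
      -- the degree by two, so it applies precisely here.
      · obtain ⟨a, rfl⟩ : ∃ a, i = a + 1 := ⟨i - 1, by omega⟩
        rw [h.recursion hn (by omega), pow_succ']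
        nth_rewrite 1 [quartic]
        rw [Finset.sum_mul, laurentFunctional_sum]
        refine Finset.sum_congr rfl fun s _ => ?_
        rw [laurentFunctional_C_mul_X_pow_mul, ih _ (by omega)]
        congr 2
        push_cast
        ring

/-! ### The representing measure -/

/-- The measure with weights `w l` at the points of the curve with abscissas `x l`. -/
def curveMeasure {ι : Type*} [Fintype ι] (q : Fin 5 → ℝ) (x w : ι → ℝ) : Measure (ℝ × ℝ) :=
  ∑ l, ENNReal.ofReal (w l) • Measure.dirac (x l, (quartic q).eval (x l) / x l)

variable {ι : Type*} [Fintype ι] {x w : ι → ℝ}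

lemma eval_curvePoly (q : Fin 5 → ℝ) (z : ℝ × ℝ) :
    MvPolynomial.eval ![z.1, z.2] (curvePoly q) = z.1 * z.2 - (quartic q).eval z.1 := by
  simp [curvePoly, quartic, Polynomial.eval_finsetSum]

lemma support_curveMeasure (q : Fin 5 → ℝ) (hx : ∀ l, x l ≠ 0) :
    (curveMeasure q x w).support ⊆ zeroSet (curvePoly q) := by
  have hset : zeroSet (curvePoly q) = {z | z.1 * z.2 - (quartic q).eval z.1 = 0} := by
    ext z
    simp [zeroSet, eval_curvePoly]
  have hclosed : IsClosed (zeroSet (curvePoly q)) := by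
    rw [hset]
    exact isClosed_eq (by fun_prop) continuous_const
  refine Measure.support_subset_of_isClosed hclosed ?_
  rw [mem_ae_iff, curveMeasure, Measure.finsetSum_apply]
  refine Finset.sum_eq_zero fun l _ => ?_
  rw [Measure.smul_apply, Measure.dirac_apply' _ hclosed.measurableSet.compl,
    Set.indicator_of_notMem, smul_zero]
  rw [Set.notMem_compl_iff, hset]
  have := hx l
  simp only [Set.mem_ofPred_eq]
  field_simp
  ring

lemma integrable_curveMeasure (q : Fin 5 → ℝ) (f : ℝ × ℝ → ℝ) :
    Integrable f (curveMeasure q x w) := by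
  refine integrable_finsetSum_measure.2 fun l _ => ?_
  exact (integrable_dirac (by simp)).smul_measure ENNReal.ofReal_ne_top

lemma integral_curveMeasure (q : Fin 5 → ℝ) (hw : ∀ l, 0 ≤ w l) (f : ℝ × ℝ → ℝ) :
    ∫ z, f z ∂curveMeasure q x w = ∑ l, w l * f (x l, (quartic q).eval (x l) / x l) := by
  rw [curveMeasure, integral_finsetSum_measure fun l _ =>
    (integrable_dirac (by simp)).smul_measure ENNReal.ofReal_ne_top]
  refine Finset.sum_congr rfl fun l _ => ?_
  rw [integral_smul_measure, integral_dirac, ENNReal.toReal_ofReal (hw l), smul_eq_mul]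

/-- Expanding `x^i (P/x)^j` gives exponents between `-j` and `i + 3j`, which stay within `[-2n,
6n]`. -/
lemma laurentFunctional_atoms {γ : ℤ → ℝ} (hx : ∀ l, x l ≠ 0)
    (h : ∀ s : ℤ, -2 * n ≤ s → s ≤ 6 * n → γ s = ∑ l, w l * x l ^ s) {i j : ℕ}
    (hij : i + j ≤ 2 * n) :
    laurentFunctional γ (i - j) (quartic q ^ j) =
      ∑ l, w l * (x l ^ i * ((quartic q).eval (x l) / x l) ^ j) := by
  rw [laurentFunctional_eq_sum _ _ _ (quartic_pow_natDegree_lt q j)]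
  have : ∀ l, w l * (x l ^ i * ((quartic q).eval (x l) / x l) ^ j) =
      ∑ m ∈ Finset.range (4 * j + 1), (quartic q ^ j).coeff m *
        (w l * x l ^ (m + (i - j) : ℤ)) := by
    intro l
    rw [div_pow, ← Polynomial.eval_pow,
      Polynomial.eval_eq_sum_range' (quartic_pow_natDegree_lt q j), Finset.sum_div,
      Finset.mul_sum, Finset.mul_sum]
    refine Finset.sum_congr rfl fun m _ => ?_
    rw [zpow_add₀ (hx l), zpow_sub₀ (hx l), zpow_natCast, zpow_natCast, zpow_natCast]
    ring
  simp only [this]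
  rw [Finset.sum_comm]
  refine Finset.sum_congr rfl fun m hm => ?_
  rw [Finset.mem_range] at hm
  rw [h _ (by omega) (by omega), Finset.mul_sum]

end QuarticTMP

end

theorem theorem4p1 (n : ℕ) (q : Fin 5 → ℝ) (hq0 : q 0 ≠ 0) (hq4 : q 4 = 1)
    (β : ℕ → ℕ → ℝ)
    (hpure : QuarticTMP.IsPure n β (QuarticTMP.curvePoly q))
    (ht : ∃ t₁ t₂ t₃ : ℝ,
      QuarticTMP.CentralBlockPosDef n (QuarticTMP.gamma n q β t₁ t₂ t₃) ∧
      QuarticTMP.FirstCondition n q β t₁ t₂ t₃ ∧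
      QuarticTMP.SecondCondition n (QuarticTMP.gamma n q β t₁ t₂ t₃) t₂ t₃ ∧
      QuarticTMP.ThirdCondition n (QuarticTMP.gamma n q β t₁ t₂ t₃) t₃) :
    ∃ μ : MeasureTheory.Measure (ℝ × ℝ),
      QuarticTMP.IsRepresentingMeasure n β
        (QuarticTMP.zeroSet (QuarticTMP.curvePoly q)) μ := by
  obtain ⟨t₁, t₂, t₃, hA, h₁, h₂, h₃⟩ := ht
  have hn : 4 ≤ n := (QuarticTMP.four_le_totalDegree_curvePoly hq4).trans hpure.1
  obtain ⟨x, w, hx, hw, hγ⟩ :=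
    QuarticTMP.exists_laurent_atoms (QuarticTMP.hankel_posDef hn hA h₁ h₂ h₃)
  refine ⟨QuarticTMP.curveMeasure q x w, QuarticTMP.support_curveMeasure q hx, fun i j hij =>
    ⟨QuarticTMP.integrable_curveMeasure q _, ?_⟩⟩
  rw [QuarticTMP.beta_eq_laurentFunctional hn hq0 hq4 hpure t₁ t₂ t₃ j i hij,
    QuarticTMP.laurentFunctional_atoms hx hγ hij, QuarticTMP.integral_curveMeasure q hw]
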